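/- Let $V$ be a set of $N\ge 1$ nodes with a distinguished root, and let each node $u$ have an upload capacity $\bar d_u\ge 2$. A configuration is a set $E$ of directed links between nodes; it is admissible if every non-root node has at most one incoming link, the root has no incoming link from a node of $V$ (it has a permanent link from an external server), and each node $u$ has at most $\bar d_u$ outgoing links. The depth of a node is the minimum number of hops of a directed path in $(V,E)$ from the root to it, and $+\infty$ if there is no such path. A node is available if it has an incoming link (the root always has one) and has fewer than $\bar d_u$ outgoing links. The ordered pairs of nodes carry independent Poisson clocks of rate $1/N$. Whenever the clock of $(u,v)$ ticks, $u$ samples $v$: if $v$ is available and $\operatorname{depth}(v)+1<\operatorname{depth}(u)$, then $u$ removes its incoming link (if any) and the link from $v$ to $u$ is built; otherwise nothing happens. The initial configuration is admissible and independent of the clocks. Let $Z_i(t)$ be the number of nodes of depth at most $i$ at time $t$, and let $$l_c=\lceil\log_2(N+1)\rceil-1,\qquad l_\alpha=\lceil\log_2((1-\alpha)N+1)\rceil-1 .$$ Let $\alpha\in(0,1/2)$ and let $T_1$ be the first time at which $Z_{l_c+1}=N$, i.e. at which all nodes have depth at most $l_c+1$ ($T_1=\infty$ if there is no such time). Then,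 given that $Z_{l_\alpha}(0)\ge(1-\alpha)N$ (an event assumed to have positive probability), for every $t\ge 0$, $$P\left[T_1\le t \,\middle|\, Z_{l_\alpha}(0)\ge(1-\alpha)N\right]\;\ge\;\left[1-e^{-(1-2\alpha)t/2}\right]^{\alpha N}.$$ -/

import Mathlib

open MeasureTheory ProbabilityTheory
open scoped NNReal ENNReal

namespace TreeBalance

/-! ### Link configurations

The nodes form a finite type `V`, one of them is the root, and a configuration is the finite set
`E` of directed links; `(v, u) ∈ E` is a link from `v` to `u`. The link from the server to the root
is always present and is not listed in `E`. -/

section Graph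

variable {V : Type*} [DecidableEq V]

/-- `ReachIn root E n u`: there is a directed path of `n` hops in `E` from the root to `u`. -/
def ReachIn (root : V) (E : Finset (V × V)) : ℕ → V → Prop
  | 0, u => u = root
  | n + 1, u => ∃ w, ReachIn root E n w ∧ (w, u) ∈ E

/-- The depth of `u`: the minimum number of hops from the root to `u`, and `⊤` if there is no path
from the root to `u`. -/
noncomputable def depth (root : V) (E : Finset (V × V)) (u : V) : ℕ∞ :=
  ⨅ (n : ℕ) (_ : ReachIn root E n u), (n : ℕ∞)

/-- The number of outgoing links of `u`. -/
def outdeg (E : Finset (V × V)) (u : V) : ℕ := (E.filter (fun e => e.1 = u)).card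

/-- The number of incoming links of `u` (apart from the link from the server to the root). -/
def indeg (E : Finset (V × V)) (u : V) : ℕ := (E.filter (fun e => e.2 = u)).card

/-- A node is available if it has an incoming link (which the root has from the server) and has
spare upload capacity. -/
def Available (root : V) (dbar : V → ℕ) (E : Finset (V × V)) (v : V) : Prop :=
  (v = root ∨ ∃ w, (w, v) ∈ E) ∧ outdeg E v < dbar v

/-- Admissible configurations: every node has at most one incoming link, the one of the root being
the link from the server, and node `u` has at most `dbar u` outgoing links. -/
structure Admissible (root : V) (dbar : V → ℕ) (E : Finset (V × V)) : Prop where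
  indeg_root : indeg E root = 0
  indeg_le : ∀ u, indeg E u ≤ 1
  outdeg_le : ∀ u, outdeg E u ≤ dbar u

open scoped Classical in
/-- The configuration after node `u` samples node `v`: if `v` is available and the depth of `v` is
less than the depth of `u` by at least two, then `u` removes its incoming link, if there is one, and
the link from `v` to `u` is built; otherwise nothing happens. -/
noncomputable def update (root : V) (dbar : V → ℕ) (E : Finset (V × V)) (u v : V) :
    Finset (V × V) :=
  if Available root dbar E v ∧ depth root E v + 1 < depth root E u then
    insert (v, u) (E.filter (fun e => e.2 ≠ u))
  else E

/-- The number of nodes of depth at most `i`. -/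
noncomputable def numWithin (root : V) (E : Finset (V × V)) (i : ℕ) : ℕ :=
  {u : V | depth root E u ≤ (i : ℕ∞)}.ncard

end Graph

/-! ### The random evolution -/

/-- A Poisson process of rate `r`: a counting process that starts at `0`, has nondecreasing
right-continuous paths and independent increments, the increment over `(s, t]` having the Poisson
law with mean `r * (t - s)`. -/
structure IsPoissonProcess {Ω : Type*} [MeasurableSpace Ω] (C : ℝ≥0 → Ω → ℕ) (r : ℝ≥0)
    (P : Measure Ω) : Prop where
  measurable : ∀ t, Measurable (C t)
  zero : ∀ᵐ ω ∂P, C 0 ω = 0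
  mono : ∀ᵐ ω ∂P, Monotone (fun t => C t ω)
  rightCont : ∀ᵐ ω ∂P, ∀ t, ContinuousWithinAt (fun s => C s ω) (Set.Ici t) t
  indepIncrements : HasIndepIncrements C P
  law : ∀ s t, s ≤ t → HasLaw (fun ω => C t ω - C s ω) (poissonMeasure (r * (t - s))) P

/-- The path `g` of configurations is driven by the path `c` of the clocks, where the clock `(u, v)`
ticks when `u` samples `v`: over a time interval `(s, t]` without ticks the configuration does not
change, and if the only tick in `(s, t]` is one tick of the clock `(u, v)`, the configuration
changes according to `update`. When on bounded intervals there are finitely many ticks and no two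
of them are simultaneous, this determines `g` from `g 0`. -/
def DrivenBy {V : Type*} [DecidableEq V] (root : V) (dbar : V → ℕ) (c : V × V → ℝ≥0 → ℕ)
    (g : ℝ≥0 → Finset (V × V)) : Prop :=
  (∀ s t, s ≤ t → (∀ p, c p t = c p s) → g t = g s) ∧
  (∀ s t u v, s ≤ t → c (u, v) t = c (u, v) s + 1 →
    (∀ p, p ≠ (u, v) → c p t = c p s) → g t = update root dbar (g s) u v)

/-- `G` is the random evolution of the network: the ordered pairs of nodes carry independent
Poisson clocks of rate `1 / N`, where `N` is the number of nodes, the initial configuration is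
admissible and independent of the clocks, and `G` is driven by the clocks. -/
structure IsNetworkProcess {V Ω : Type*} [Fintype V] [DecidableEq V] [MeasurableSpace Ω]
    (root : V) (dbar : V → ℕ) (C : V × V → ℝ≥0 → Ω → ℕ) (G : ℝ≥0 → Ω → Finset (V × V))
    (P : Measure Ω) : Prop where
  poisson : ∀ p, IsPoissonProcess (C p) (1 / (Fintype.card V : ℝ≥0)) P
  indep_clocks : iIndepFun (fun p ω t => C p t ω) P
  measurable : ∀ t, Measurable (G t)
  indep_init : IndepFun (G 0) (fun ω p t => C p t ω) P
  admissible_init : ∀ᵐ ω ∂P, Admissible root dbar (G 0 ω)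
  driven : ∀ᵐ ω ∂P, DrivenBy root dbar (fun p t => C p t ω) (fun t => G t ω)

/-! ### Levels and the hitting time -/

/-- `⌈log₂ (N + 1)⌉ - 1`, a nonnegative integer for `N ≥ 1`. -/
noncomputable def levelC (N : ℕ) : ℕ := ⌈Real.logb 2 ((N : ℝ) + 1)⌉₊ - 1

/-- `⌈log₂ ((1 - α) N + 1)⌉ - 1`, a nonnegative integer for `N ≥ 1` and `α < 1`. -/
noncomputable def levelA (α : ℝ) (N : ℕ) : ℕ := ⌈Real.logb 2 ((1 - α) * (N : ℝ) + 1)⌉₊ - 1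

/-- The first time at which all nodes have depth at most `levelC N + 1`; it is `⊤` if there is no
such time. -/
noncomputable def coverTime {V Ω : Type*} [Fintype V] [DecidableEq V] (root : V)
    (G : ℝ≥0 → Ω → Finset (V × V)) : Ω → WithTop ℝ≥0 :=
  hittingAfter (fun t ω => numWithin root (G t ω) (levelC (Fintype.card V) + 1))
    {Fintype.card V} 0

end TreeBalance

namespace TreeBalance

/-! ### Depths and the update rule -/

section GraphLemmas

variable {V : Type*} {root : V} {dbar : V → ℕ} {E : Finset (V × V)}

/-! Rewiring never increases a depth, so Z_l never decreases. An admissible configuration has at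
most N links, so at most N/2 nodes have two or more outgoing links. Hence, once Z_l ≥ (1/2 + κ)N, at
all later times at least κN nodes of depth at most l have spare capacity. A node deeper than l + 1
that samples any of them gets depth at most l + 1. As the clocks have rate 1/N, each deep node is
repaired at rate at least κ, so k deep nodes disappear by time t with probability at least (1 -
e^(-κt))^k, as for k independent exponential times. Here l = l_c, κ = 1/2 - α and k ≤ αN.

The rates are handled by cutting [0, t] into n equal periods and keeping only the histories with at
most one tick per period (`IsNetworkProcess.sum_le_measureReal`). On these the configuration is a
function of the initial one and the tick pattern. `le_sum_tickUpdate` is the comparison over one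
period and `le_sum_run` iterates it. The total error is O(1/n) and vanishes in
`measureReal_deep_eq_empty_ge_rpow`. -/

theorem depth_le_of_reachIn {n : ℕ} {u : V} (h : ReachIn root E n u) : depth root E u ≤ n :=
  iInf₂_le_of_le n h le_rfl

theorem depth_le_iff {n : ℕ} {u : V} :
    depth root E u ≤ n ↔ ∃ m ≤ n, ReachIn root E m u := by
  constructor
  · intro h
    by_contra! hc
    have h1 : ((n + 1 : ℕ) : ℕ∞) ≤ depth root E u := by
      refine le_iInf₂ fun m hm => ?_
      have : n < m := by
        by_contra hlt
        exact hc m (by omega) hm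
      exact_mod_cast this
    have h2 : ((n + 1 : ℕ) : ℕ∞) ≤ n := h1.trans h
    have h3 : n + 1 ≤ n := by exact_mod_cast h2
    omega
  · rintro ⟨m, hm, hr⟩
    exact (depth_le_of_reachIn hr).trans (by exact_mod_cast hm)

open scoped Classical in
/-- The nodes of depth greater than `l`. -/
noncomputable def deep [Fintype V] (root : V) (l : ℕ) (E : Finset (V × V)) : Finset V :=
  Finset.univ.filter fun u => (l : ℕ∞) < depth root E u

theorem mem_deep [Fintype V] {l : ℕ} {u : V} : u ∈ deep root l E ↔ (l : ℕ∞) < depth root E u := by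
  simp [deep]

theorem depth_root : depth root E root = 0 := by
  have : depth root E root ≤ (0 : ℕ) := depth_le_of_reachIn rfl
  simpa using this

theorem depth_le_succ_of_mem {u v : V} (h : (v, u) ∈ E) :
    depth root E u ≤ depth root E v + 1 := by
  rcases eq_or_ne (depth root E v) ⊤ with hv | hv
  · simp [hv]
  · obtain ⟨n, hn⟩ := ENat.ne_top_iff_exists.1 hv
    obtain ⟨m, hm, hr⟩ := depth_le_iff.1 hn.ge
    have h1 : depth root E u ≤ ((m + 1 : ℕ) : ℕ∞) := depth_le_of_reachIn ⟨v, hr, h⟩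
    rw [← hn]
    exact h1.trans (by exact_mod_cast Nat.succ_le_succ hm)

theorem numWithin_mono [Finite V] {l m : ℕ} (h : l ≤ m) : numWithin root E l ≤ numWithin root E m := by
  refine Set.ncard_le_ncard (fun u hu => ?_) (Set.toFinite _)
  exact (show depth root E u ≤ (l : ℕ∞) from hu).trans (by exact_mod_cast h)

variable [DecidableEq V]

/-- A link that shortens the depth of its target increases no depth. -/
theorem depth_insert_le {u v : V} (huv : depth root E v + 1 < depth root E u) (w : V) :
    depth root (insert (v, u) (E.filter (fun e => e.2 ≠ u))) w ≤ depth root E w := by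
  set E' := insert (v, u) (E.filter (fun e => e.2 ≠ u)) with hE'
  have hmem : (v, u) ∈ E' := Finset.mem_insert_self _ _
  -- Strong induction on the hop count. A path to `u` is replaced by a path to `v`, at least two
  -- hops shorter, and the new link; whether that path to `v` used the removed link does not matter.
  have key : ∀ n w, ReachIn root E n w → depth root E' w ≤ n := by
    intro n
    induction n using Nat.strong_induction_on with
    | _ n ih =>
      intro w hw
      rcases eq_or_ne w u with rfl | hne
      · have hvn : depth root E v + 1 < n := huv.trans_le (depth_le_of_reachIn hw)
        have hvt : depth root E v ≠ ⊤ := by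
          intro h
          simp [h] at hvn
        obtain ⟨m, hm⟩ := ENat.ne_top_iff_exists.1 hvt
        have hmn : m + 1 < n := by
          rw [← hm] at hvn
          exact_mod_cast hvn
        obtain ⟨k, hk, hr⟩ := depth_le_iff.1 hm.ge
        have h1 : depth root E' v ≤ k := ih k (by omega) v hr
        calc depth root E' w ≤ depth root E' v + 1 := depth_le_succ_of_mem hmem
          _ ≤ (k : ℕ∞) + 1 := by gcongr
          _ ≤ n := by exact_mod_cast (by omega : k + 1 ≤ n)
      · cases n with
        | zero => exact depth_le_of_reachIn hw
        | succ n =>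
          obtain ⟨x, hx, hxw⟩ := hw
          have hxw' : (x, w) ∈ E' := by simp [hE', hxw, hne]
          calc depth root E' w ≤ depth root E' x + 1 := depth_le_succ_of_mem hxw'
            _ ≤ (n : ℕ∞) + 1 := by
              gcongr
              exact ih n (by omega) x hx
            _ = ((n + 1 : ℕ) : ℕ∞) := by push_cast; rfl
  exact le_iInf₂ fun n hn => key n w hn

theorem depth_update_le (u v w : V) :
    depth root (update root dbar E u v) w ≤ depth root E w := by
  unfold update
  split_ifs with h
  · exact depth_insert_le h.2 w
  · exact le_rfl

theorem depth_update_self_le {u v : V} (hv : Available root dbar E v)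
    (huv : depth root E v + 1 < depth root E u) :
    depth root (update root dbar E u v) u ≤ depth root E v + 1 := by
  have h := depth_update_le (root := root) (dbar := dbar) (E := E) u v v
  have hmem : (v, u) ∈ update root dbar E u v := by simp [update, hv, huv]
  exact (depth_le_succ_of_mem hmem).trans (by gcongr)

theorem Admissible.update (hE : Admissible root dbar E) (u v : V) :
    Admissible root dbar (update root dbar E u v) := by
  unfold TreeBalance.update
  split_ifs with h
  · obtain ⟨⟨-, hav⟩, hd⟩ := h
    have hur : u ≠ root := by
      rintro rfl
      simp [depth_root] at hd
    refine ⟨?_, fun w => ?_, fun w => ?_⟩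
    · have h0 := hE.indeg_root
      simp only [indeg, Finset.card_eq_zero, Finset.filter_eq_empty_iff, Finset.mem_insert,
        Finset.mem_filter] at h0 ⊢
      rintro e (rfl | ⟨he, -⟩)
      · exact hur
      · exact h0 he
    · rcases eq_or_ne w u with rfl | hne
      · refine Finset.card_le_one.2 ?_
        simp only [Finset.mem_filter, Finset.mem_insert]
        grind
      · refine le_trans (Finset.card_le_card ?_) (hE.indeg_le w)
        intro e
        simp only [Finset.mem_filter, Finset.mem_insert]
        grind
    · rcases eq_or_ne w v with rfl | hne
      · refine le_trans ?_ (Nat.succ_le_of_lt hav)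
        refine le_trans (Finset.card_le_card (t := insert (w, u) (E.filter (fun e => e.1 = w))) ?_)
          (Finset.card_insert_le _ _)
        intro e
        simp only [Finset.mem_filter, Finset.mem_insert]
        grind
      · refine le_trans (Finset.card_le_card ?_) (hE.outdeg_le w)
        intro e
        simp only [Finset.mem_filter, Finset.mem_insert]
        grind
  · exact hE

theorem available_of_depth_le {n : ℕ} {v : V} (hv : depth root E v ≤ n)
    (ho : outdeg E v < dbar v) : Available root dbar E v := by
  refine ⟨?_, ho⟩
  obtain ⟨m, -, hm⟩ := depth_le_iff.1 hv
  cases m with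
  | zero => exact Or.inl hm
  | succ m =>
    obtain ⟨w, -, hw⟩ := hm
    exact Or.inr ⟨w, hw⟩

variable [Fintype V]

theorem numWithin_add_card_deep (l : ℕ) :
    numWithin root E l + (deep root l E).card = Fintype.card V := by
  classical
  have h : {u : V | depth root E u ≤ (l : ℕ∞)} = ((deep root l E)ᶜ : Finset V) := by
    ext u
    simp [mem_deep]
  rw [numWithin, h, Set.ncard_coe_finset, add_comm, Finset.card_add_card_compl]

theorem numWithin_le_numWithin_update (l : ℕ) (u v : V) :
    numWithin root E l ≤ numWithin root (update root dbar E u v) l :=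
  Set.ncard_le_ncard (fun w hw => (depth_update_le u v w).trans hw) (Set.toFinite _)

theorem deep_update_subset (l : ℕ) (u v : V) :
    deep root l (update root dbar E u v) ⊆ deep root l E := fun w hw =>
  mem_deep.2 ((mem_deep.1 hw).trans_le (depth_update_le u v w))

/-- A source of depth at most `l` and a target deeper than `l + 1` satisfy the strict inequality of
the rule; this is why covering is asked one level below the one where spare capacity is counted. -/
theorem card_deep_update_lt {l : ℕ} {u v : V} (hu : u ∈ deep root (l + 1) E)
    (hv : Available root dbar E v) (hvl : depth root E v ≤ l) :
    (deep root (l + 1) (update root dbar E u v)).card + 1 ≤ (deep root (l + 1) E).card := by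
  refine Finset.card_lt_card ⟨deep_update_subset _ u v, fun hsub => ?_⟩
  have hle : depth root E v + 1 ≤ ((l + 1 : ℕ) : ℕ∞) := by push_cast; gcongr
  have h1 := depth_update_self_le hv (hle.trans_lt (mem_deep.1 hu))
  exact absurd (mem_deep.1 (hsub hu)) (not_lt.2 (h1.trans hle))

/-! ### Counting spare capacity -/

open scoped Classical in
/-- The nodes of depth at most `l` that have spare upload capacity. -/
noncomputable def spare (root : V) (dbar : V → ℕ) (l : ℕ) (E : Finset (V × V)) : Finset V :=
  Finset.univ.filter fun v => depth root E v ≤ (l : ℕ∞) ∧ outdeg E v < dbar v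

theorem Admissible.card_le (hE : Admissible root dbar E) : E.card ≤ Fintype.card V := by
  rw [Finset.card_eq_sum_card_fiberwise (f := Prod.snd) (t := Finset.univ) (by simp)]
  calc _ ≤ ∑ _u : V, 1 := Finset.sum_le_sum fun u _ => hE.indeg_le u
    _ = _ := by simp

/-- At most half of the nodes use up their upload capacity. -/
theorem Admissible.numWithin_le (hE : Admissible root dbar E) (hdbar : ∀ u, 2 ≤ dbar u) (l : ℕ) :
    2 * numWithin root E l ≤ 2 * (spare root dbar l E).card + Fintype.card V := by
  classical
  set full : Finset V := Finset.univ.filter fun v => 2 ≤ outdeg E v with hfull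
  -- Links counted by source here; counted by target, there are at most N of them.
  have h1 : 2 * full.card ≤ E.card := by
    rw [Finset.card_eq_sum_card_fiberwise (s := E) (f := Prod.fst) (t := Finset.univ) (by simp)]
    calc 2 * full.card = ∑ _v ∈ full, 2 := by simp [mul_comm]
      _ ≤ ∑ v ∈ full, outdeg E v := Finset.sum_le_sum fun v hv => by simpa [hfull] using hv
      _ ≤ ∑ v, outdeg E v := Finset.sum_le_sum_of_subset (Finset.subset_univ _)
  have h2 : numWithin root E l ≤ (spare root dbar l E).card + full.card := by
    refine le_trans ?_ (Finset.card_union_le _ _)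
    rw [numWithin, ← Set.ncard_coe_finset]
    refine Set.ncard_le_ncard (fun v hv => ?_) (Set.toFinite _)
    have hv' : depth root E v ≤ (l : ℕ∞) := hv
    have := hdbar v
    by_cases h : outdeg E v < dbar v
    · simp [spare, hv', h]
    · have : 2 ≤ outdeg E v := by omega
      simp [hfull, this]
  have := hE.card_le
  omega

end GraphLemmas

theorem levelA_le_levelC {α : ℝ} (hα : 0 ≤ α) (N : ℕ) (hα₁ : α ≤ 1) : levelA α N ≤ levelC N := by
  unfold levelA levelC
  refine Nat.sub_le_sub_right (Nat.ceil_le_ceil ?_) 1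
  have hN : (0 : ℝ) ≤ N := N.cast_nonneg
  refine Real.logb_le_logb_of_le one_lt_two ?_ ?_ <;> nlinarith

/-! ### The discrete chain driven by single ticks -/

theorem add_pow_le_pow_add_mul {x δ : ℝ} (hx : 0 ≤ x) (hδ : 0 ≤ δ) (h1 : x + δ ≤ 1) (k : ℕ) :
    (x + δ) ^ k ≤ x ^ k + k * δ := by
  induction k with
  | zero => simp
  | succ k ih =>
    have h2 : (x + δ) ^ k ≤ 1 := pow_le_one₀ (by linarith) h1
    have h3 : x * (x + δ) ^ k ≤ x * (x ^ k + k * δ) := mul_le_mul_of_nonneg_left ih hx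
    have h4 : δ * (x + δ) ^ k ≤ δ := mul_le_of_le_one_right hδ h2
    have h5 : x * (k * δ) ≤ k * δ := mul_le_of_le_one_left (by positivity) (by linarith)
    push_cast
    calc (x + δ) ^ (k + 1) = x * (x + δ) ^ k + δ * (x + δ) ^ k := by ring
      _ ≤ x * x ^ k + x * (k * δ) + δ := by linarith
      _ ≤ _ := by rw [pow_succ']; linarith

/-- First-order expansion with a crude remainder: only its order δ² matters, since it is summed over
n periods with δ of order 1/n. -/
theorem add_pow_succ_le {x δ : ℝ} (hx : 0 ≤ x) (hδ : 0 ≤ δ) (h1 : x + δ ≤ 1) (k : ℕ) :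
    (x + δ) ^ (k + 1) ≤ x ^ (k + 1) + (k + 1) * δ * x ^ k + (k + 1) ^ 2 * δ ^ 2 := by
  induction k with
  | zero => simp; positivity
  | succ k ih =>
    have h2 := add_pow_le_pow_add_mul hx hδ h1 (k + 1)
    have h3 := mul_le_mul_of_nonneg_left ih hx
    have h4 := mul_le_mul_of_nonneg_left h2 hδ
    have h5 : x * ((k + 1) ^ 2 * δ ^ 2) ≤ (k + 1) ^ 2 * δ ^ 2 :=
      mul_le_of_le_one_left (by positivity) (by linarith)
    have h6 : 0 ≤ (k : ℝ) * δ ^ 2 := by positivity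
    push_cast at h4 ⊢
    calc (x + δ) ^ (k + 1 + 1) = x * (x + δ) ^ (k + 1) + δ * (x + δ) ^ (k + 1) := by ring
      _ ≤ x * (x ^ (k + 1) + (k + 1) * δ * x ^ k + (k + 1) ^ 2 * δ ^ 2)
          + δ * (x ^ (k + 1) + (k + 1) * δ) := by linarith
      _ = x ^ (k + 1 + 1) + (k + 1 + 1) * δ * x ^ (k + 1) + x * ((k + 1) ^ 2 * δ ^ 2)
          + (k + 1) * δ ^ 2 := by ring
      _ ≤ _ := by nlinarith [sq_nonneg δ]

/-! ### Configurations after periods with at most one tick -/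

section Chain

variable {V : Type*} [DecidableEq V] {root : V} {dbar : V → ℕ} {E : Finset (V × V)}

/-- The configuration after at most one tick. -/
noncomputable def tickUpdate (root : V) (dbar : V → ℕ) (E : Finset (V × V)) :
    Option (V × V) → Finset (V × V)
  | none => E
  | some p => update root dbar E p.1 p.2

/-- The configuration after `n` periods, each with at most one tick. -/
noncomputable def run (root : V) (dbar : V → ℕ) :
    (n : ℕ) → Finset (V × V) → (Fin n → Option (V × V)) → Finset (V × V)
  | 0, E, _ => E
  | n + 1, E, y => run root dbar n (tickUpdate root dbar E (y 0)) (Fin.tail y)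

/-- The numbers of ticks of the clocks during a period with at most one tick. -/
def tickCount : Option (V × V) → V × V → ℕ
  | none, _ => 0
  | some p, q => if q = p then 1 else 0

theorem DrivenBy.eq_run {c : V × V → ℝ≥0 → ℕ} {g : ℝ≥0 → Finset (V × V)}
    (hg : DrivenBy root dbar c g) (n : ℕ) (τ : ℕ → ℝ≥0) (hτ : Monotone τ)
    (y : Fin n → Option (V × V))
    (hy : ∀ (i : Fin n) p, c p (τ (i + 1)) = c p (τ i) + tickCount (y i) p) :
    g (τ n) = run root dbar n (g (τ 0)) y := by
  induction n generalizing τ with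
  | zero => rfl
  | succ n ih =>
    have h1 : g (τ 1) = tickUpdate root dbar (g (τ 0)) (y 0) := by
      have h0 := hy 0
      simp only [Fin.val_zero, zero_add] at h0
      cases hy0 : y 0 with
      | none =>
        rw [hy0] at h0
        exact hg.1 _ _ (hτ zero_le_one) fun p => by simpa [tickCount] using h0 p
      | some p =>
        rw [hy0] at h0
        refine hg.2 _ _ p.1 p.2 (hτ zero_le_one) (by simpa [tickCount] using h0 p) fun q hq => ?_
        simpa [tickCount, show q ≠ p from hq] using h0 q
    rw [run, ← h1]
    exact ih (fun i => τ (i + 1)) (fun i j hij => hτ (Nat.succ_le_succ hij)) (Fin.tail y)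
      fun i p => by simpa [Fin.tail] using hy i.succ p

theorem Admissible.tickUpdate (hE : Admissible root dbar E) (y : Option (V × V)) :
    Admissible root dbar (tickUpdate root dbar E y) := by
  cases y with
  | none => exact hE
  | some p => exact hE.update _ _

variable [Fintype V]

theorem numWithin_le_numWithin_tickUpdate (l : ℕ) (y : Option (V × V)) :
    numWithin root E l ≤ numWithin root (tickUpdate root dbar E y) l := by
  cases y with
  | none => exact le_rfl
  | some p => exact numWithin_le_numWithin_update _ _ _

theorem card_deep_tickUpdate_le (l : ℕ) (y : Option (V × V)) :
    (deep root l (tickUpdate root dbar E y)).card ≤ (deep root l E).card := by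
  cases y with
  | none => exact le_rfl
  | some p => exact Finset.card_le_card (deep_update_subset _ _ _)

theorem card_deep_tickUpdate_lt {l : ℕ} {p : V × V}
    (hp : p ∈ deep root (l + 1) E ×ˢ spare root dbar l E) :
    (deep root (l + 1) (tickUpdate root dbar E (some p))).card + 1
      ≤ (deep root (l + 1) E).card := by
  obtain ⟨h1, h2⟩ := Finset.mem_product.1 hp
  simp only [spare, Finset.mem_filter, Finset.mem_univ, true_and] at h2
  exact card_deep_update_lt h1 (available_of_depth_le h2.1 h2.2) h2.1

theorem Admissible.mul_le_card_spare (hE : Admissible root dbar E) (hdbar : ∀ u, 2 ≤ dbar u)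
    {l : ℕ} {κ : ℝ} (hl : (1 / 2 + κ) * Fintype.card V ≤ numWithin root E l) :
    κ * Fintype.card V ≤ (spare root dbar l E).card := by
  have h : (2 * numWithin root E l : ℝ) ≤ 2 * (spare root dbar l E).card + Fintype.card V := by
    exact_mod_cast hE.numWithin_le hdbar l
  linarith

/-- With k deep nodes, at least k · κN ticks, each of weight `s`, lower k. To first order in r =
κN`s`, the mean of (1 - a)^k after the period is therefore at least its value when each deep node is
removed independently with probability r, namely (1 - a(1 - r))^k. The error is the missing mass `ε`
plus a second-order term. -/
theorem le_sum_tickUpdate (hE : Admissible root dbar E) (hdbar : ∀ u, 2 ≤ dbar u)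
    {l : ℕ} {κ : ℝ} (hκ : 0 ≤ κ) (hl : (1 / 2 + κ) * Fintype.card V ≤ numWithin root E l)
    {w : Option (V × V) → ℝ} (hw : ∀ y, 0 ≤ w y) {ε s : ℝ} (hwε : 1 - ε ≤ ∑ y, w y)
    (hε : 0 ≤ ε) (hs : ∀ p, w (some p) = s) (hs0 : 0 ≤ s)
    (hr : κ * Fintype.card V * s ≤ 1) {a : ℝ} (ha₀ : 0 ≤ a) (ha₁ : a ≤ 1) :
    (1 - a * (1 - κ * Fintype.card V * s)) ^ (deep root (l + 1) E).card
        - (ε + (Fintype.card V * (κ * Fintype.card V * s)) ^ 2) ≤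
      ∑ y, w y * (1 - a) ^ (deep root (l + 1) (tickUpdate root dbar E y)).card := by
  set r := κ * Fintype.card V * s with hrdef
  have hr0 : 0 ≤ r := by positivity
  have hb0 : 0 ≤ 1 - a := by linarith
  have hb1 : 1 - a ≤ 1 := by linarith
  obtain hk | ⟨k, hk⟩ : (deep root (l + 1) E).card = 0 ∨ ∃ k, (deep root (l + 1) E).card = k + 1 :=
    by cases h : (deep root (l + 1) E).card <;> simp
  · have h0 : ∀ y, (deep root (l + 1) (tickUpdate root dbar E y)).card = 0 := fun y =>
      Nat.le_zero.1 ((card_deep_tickUpdate_le _ y).trans hk.le)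
    simp only [hk, h0, pow_zero, mul_one]
    nlinarith [sq_nonneg (Fintype.card V * r)]
  · rw [hk]
    set good := (deep root (l + 1) E ×ˢ spare root dbar l E).image some with hgood
    have hcard : (k + 1 : ℝ) * r ≤ good.card * s := by
      rw [hgood, Finset.card_image_of_injective _ (Option.some_injective _), Finset.card_product, hk]
      have := hE.mul_le_card_spare hdbar hl
      push_cast
      calc (k + 1 : ℝ) * r = (k + 1) * (κ * Fintype.card V) * s := by rw [hrdef]; ring
        _ ≤ _ := by gcongr
    -- A good tick gains the difference (1 - a)^k - (1 - a)^(k + 1) = a(1 - a)^k; no other tick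
    -- loses anything.
    have hstep : ∀ y, w y * (1 - a) ^ (k + 1)
          + (if y ∈ good then s * (a * (1 - a) ^ k) else 0) ≤
        w y * (1 - a) ^ (deep root (l + 1) (tickUpdate root dbar E y)).card := by
      intro y
      split_ifs with hy
      · obtain ⟨p, hp, rfl⟩ := Finset.mem_image.1 hy
        have h1 := card_deep_tickUpdate_lt hp
        rw [hs, ← mul_add]
        refine mul_le_mul_of_nonneg_left ?_ hs0
        calc (1 - a) ^ (k + 1) + a * (1 - a) ^ k = (1 - a) ^ k := by ring
          _ ≤ _ := pow_le_pow_of_le_one hb0 hb1 (by omega)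
      · rw [add_zero]
        exact mul_le_mul_of_nonneg_left
          (pow_le_pow_of_le_one hb0 hb1 (hk ▸ card_deep_tickUpdate_le _ y)) (hw y)
    have hsum := Finset.sum_le_sum fun y (_ : y ∈ Finset.univ) => hstep y
    rw [Finset.sum_add_distrib, ← Finset.sum_mul, Finset.sum_ite_mem, Finset.univ_inter,
      Finset.sum_const, nsmul_eq_mul] at hsum
    refine le_trans ?_ hsum
    have hra : r * a ≤ a := mul_le_of_le_one_left ha₀ hr
    -- Expansion around 1 - a with increment ra, since 1 - a(1 - r) = (1 - a) + ra.
    have h1 := add_pow_succ_le (k := k) hb0 (mul_nonneg hr0 ha₀) (by linarith)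
    have h2 : (1 - ε) * (1 - a) ^ (k + 1) ≤ (∑ y, w y) * (1 - a) ^ (k + 1) := by gcongr
    have h3 : ε * (1 - a) ^ (k + 1) ≤ ε := mul_le_of_le_one_right hε (pow_le_one₀ hb0 hb1)
    have h4 : (k + 1 : ℝ) * r * (a * (1 - a) ^ k) ≤ good.card * s * (a * (1 - a) ^ k) := by gcongr
    have hkV : (k + 1 : ℝ) ≤ Fintype.card V := by exact_mod_cast hk ▸ Finset.card_le_univ _
    have h5 : ((k + 1 : ℝ)) ^ 2 * (r * a) ^ 2 ≤ (Fintype.card V * r) ^ 2 := by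
      rw [← mul_pow]
      gcongr
      exact mul_le_of_le_one_right hr0 ha₁
    have h6 : 1 - a * (1 - r) = 1 - a + r * a := by ring
    rw [h6]
    linarith

/-- Induction on the first period, with a = (1 - r)^n in the one-period estimate. At n = 0 the power
is 0^k, with 0^0 = 1, which is the indicator of having no deep node. Total mass at most 1 keeps the
errors additive. -/
theorem le_sum_run (hdbar : ∀ u, 2 ≤ dbar u) {l : ℕ} {κ : ℝ} (hκ : 0 ≤ κ)
    {w : Option (V × V) → ℝ} (hw : ∀ y, 0 ≤ w y) {ε s : ℝ} (hwε : 1 - ε ≤ ∑ y, w y)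
    (hw₁ : ∑ y, w y ≤ 1) (hε : 0 ≤ ε) (hs : ∀ p, w (some p) = s) (hs0 : 0 ≤ s)
    (hr : κ * Fintype.card V * s ≤ 1) (n : ℕ) (E : Finset (V × V)) (hE : Admissible root dbar E)
    (hl : (1 / 2 + κ) * Fintype.card V ≤ numWithin root E l) :
    (1 - (1 - κ * Fintype.card V * s) ^ n) ^ (deep root (l + 1) E).card
        - n * (ε + (Fintype.card V * (κ * Fintype.card V * s)) ^ 2) ≤
      ∑ y : Fin n → Option (V × V),
        (∏ i, w (y i)) * (if deep root (l + 1) (run root dbar n E y) = ∅ then 1 else 0) := by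
  induction n generalizing E with
  | zero =>
    by_cases h : deep root (l + 1) E = ∅ <;> simp [run, h]
  | succ n ih =>
    set r := κ * Fintype.card V * s with hrdef
    set η := ε + (Fintype.card V * r) ^ 2 with hη
    have hη0 : 0 ≤ η := by positivity
    have hr0 : 0 ≤ r := by positivity
    rw [← (Fin.consEquiv fun _ => Option (V × V)).sum_comp, Fintype.sum_prod_type]
    simp only [Fin.consEquiv_apply, Fin.prod_univ_succ, Fin.cons_zero, Fin.cons_succ, run,
      mul_assoc, ← Finset.mul_sum]
    have h1 : ∀ y, w y * ((1 - (1 - r) ^ n) ^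
        (deep root (l + 1) (tickUpdate root dbar E y)).card - n * η) ≤ _ := fun y =>
      mul_le_mul_of_nonneg_left (ih (tickUpdate root dbar E y) (hE.tickUpdate y)
        (hl.trans (by exact_mod_cast numWithin_le_numWithin_tickUpdate l y))) (hw y)
    refine le_trans ?_ (Finset.sum_le_sum fun y _ => h1 y)
    simp only [mul_sub, Finset.sum_sub_distrib, ← Finset.sum_mul]
    have h2 := le_sum_tickUpdate hE hdbar hκ hl hw hwε hε hs hs0 hr
      (a := (1 - r) ^ n) (pow_nonneg (by linarith) n) (pow_le_one₀ (by linarith) (by linarith))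
    have h3 : (∑ y, w y) * (n * η) ≤ 1 * (n * η) := by gcongr
    rw [pow_succ]
    push_cast
    linarith

end Chain

/-! ### The law of the ticks and the limit of vanishing periods -/

section Law

variable {V Ω : Type*} [Fintype V] [DecidableEq V] [MeasurableSpace Ω] {P : Measure Ω}
  {root : V} {dbar : V → ℕ} {C : V × V → ℝ≥0 → Ω → ℕ} {G : ℝ≥0 → Ω → Finset (V × V)}

theorem IsPoissonProcess.measureReal_increments {X : ℝ≥0 → Ω → ℕ} {r : ℝ≥0}
    (hX : IsPoissonProcess X r P) {τ : ℕ → ℝ≥0} (hτ : Monotone τ) {n : ℕ} (k : Fin n → ℕ) :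
    P.real {ω | ∀ i : Fin n, X (τ (i + 1)) ω - X (τ i) ω = k i} =
      ∏ i : Fin n, (poissonMeasure (r * (τ (i + 1) - τ i))).real {k i} := by
  have h := (hX.indepIncrements n (fun i => τ i)
    (fun i j hij => hτ hij)).measure_inter_preimage_eq_mul Finset.univ
    (sets := fun i => {k i}) (fun i _ => measurableSet_singleton _)
  have hset : {ω | ∀ i : Fin n, X (τ (i + 1)) ω - X (τ i) ω = k i} =
      ⋂ i ∈ (Finset.univ : Finset (Fin n)),
        (fun ω => X (τ i.succ) ω - X (τ i.castSucc) ω) ⁻¹' {k i} := by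
    ext ω
    simp
  rw [measureReal_def, hset, h, ENNReal.toReal_prod]
  refine Finset.prod_congr rfl fun i _ => ?_
  have := (hX.law (τ i) (τ (i + 1)) (hτ (Nat.le_succ _))).measure_eq (p := fun x => x = k i)
    (measurableSet_singleton (k i))
  rw [measureReal_def]
  congr 1

/-- The event that the configuration starts at `e` and the ticks in the periods follow `y`. -/
def tickEvent (C : V × V → ℝ≥0 → Ω → ℕ) (G : ℝ≥0 → Ω → Finset (V × V)) (τ : ℕ → ℝ≥0) {n : ℕ}
    (e : Finset (V × V)) (y : Fin n → Option (V × V)) : Set Ω :=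
  G 0 ⁻¹' {e} ∩ {ω | ∀ p, ∀ i : Fin n, C p (τ (i + 1)) ω - C p (τ i) ω = tickCount (y i) p}

theorem IsNetworkProcess.measurableSet_tickEvent (hG : IsNetworkProcess root dbar C G P)
    (τ : ℕ → ℝ≥0) {n : ℕ} (e : Finset (V × V)) (y : Fin n → Option (V × V)) :
    MeasurableSet (tickEvent C G τ e y) := by
  refine (hG.measurable 0 (measurableSet_singleton e)).inter ?_
  simp only [Set.ofPred_forall]
  refine MeasurableSet.iInter fun p => MeasurableSet.iInter fun i => ?_
  exact (((hG.poisson p).measurable _).sub ((hG.poisson p).measurable _))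
    (measurableSet_singleton _)

/-- Three independences give the product: initial configuration from clocks, clocks from each other,
increments of one clock. -/
theorem IsNetworkProcess.measureReal_tickEvent (hG : IsNetworkProcess root dbar C G P)
    {τ : ℕ → ℝ≥0} (hτ : Monotone τ) {n : ℕ} (e : Finset (V × V)) (y : Fin n → Option (V × V)) :
    P.real (tickEvent C G τ e y) = P.real (G 0 ⁻¹' {e}) *
      ∏ i : Fin n, ∏ p : V × V, (poissonMeasure (1 / (Fintype.card V : ℝ≥0) *
        (τ (i + 1) - τ i))).real {tickCount (y i) p} := by
  have hD : ∀ p : V × V, MeasurableSet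
      {c : ℝ≥0 → ℕ | ∀ i : Fin n, c (τ (i + 1)) - c (τ i) = tickCount (y i) p} := by
    intro p
    simp only [Set.ofPred_forall]
    refine MeasurableSet.iInter fun i => ?_
    exact ((measurable_pi_apply (τ (i + 1))).sub (measurable_pi_apply (τ i)))
      (measurableSet_singleton _)
  have hD' : MeasurableSet {c : V × V → ℝ≥0 → ℕ |
      ∀ p, c p ∈ {c : ℝ≥0 → ℕ | ∀ i : Fin n, c (τ (i + 1)) - c (τ i) = tickCount (y i) p}} := by
    rw [Set.ofPred_forall]
    exact MeasurableSet.iInter fun p => measurable_pi_apply p (hD p)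
  have h1 := hG.indep_init.measure_inter_preimage_eq_mul _ _ (measurableSet_singleton e) hD'
  have h2 := hG.indep_clocks.measure_inter_preimage_eq_mul Finset.univ (fun p _ => hD p)
  have hset : (fun ω p t => C p t ω) ⁻¹' {c : V × V → ℝ≥0 → ℕ |
      ∀ p, c p ∈ {c : ℝ≥0 → ℕ | ∀ i : Fin n, c (τ (i + 1)) - c (τ i) = tickCount (y i) p}} =
      ⋂ p ∈ (Finset.univ : Finset (V × V)), (fun ω t => C p t ω) ⁻¹'
        {c : ℝ≥0 → ℕ | ∀ i : Fin n, c (τ (i + 1)) - c (τ i) = tickCount (y i) p} := by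
    ext ω
    simp
  rw [hset, h2] at h1
  rw [measureReal_def, tickEvent]
  refine (congrArg ENNReal.toReal (Eq.trans ?_ h1)).trans ?_
  · rw [← hset]
    rfl
  · rw [ENNReal.toReal_mul, ENNReal.toReal_prod, Finset.prod_comm]
    refine congrArg₂ _ rfl (Finset.prod_congr rfl fun p _ => ?_)
    exact (hG.poisson p).measureReal_increments hτ fun i => tickCount (y i) p

theorem prod_poissonMeasure_tickCount_none (ρ : ℝ≥0) :
    ∏ p : V × V, (poissonMeasure ρ).real {tickCount none p} =
      Real.exp (-(Fintype.card V ^ 2 * ρ)) := by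
  simp only [tickCount, poissonMeasure_real_singleton, pow_zero, Nat.factorial_zero, Nat.cast_one,
    mul_one, div_one, Finset.prod_const, Finset.card_univ, Fintype.card_prod]
  rw [← Real.exp_nat_mul]
  congr 1
  push_cast
  ring

theorem prod_poissonMeasure_tickCount_some (ρ : ℝ≥0) (q : V × V) :
    ∏ p : V × V, (poissonMeasure ρ).real {tickCount (some q) p} =
      Real.exp (-(Fintype.card V ^ 2 * ρ)) * ρ := by
  rw [← prod_poissonMeasure_tickCount_none, ← Finset.mul_prod_erase _ _ (Finset.mem_univ q),
    ← Finset.mul_prod_erase (a := q) (f := fun p => (poissonMeasure ρ).real {tickCount none p}) _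
      (Finset.mem_univ q)]
  have : ∀ p ∈ Finset.univ.erase q, (poissonMeasure ρ).real {tickCount (some q) p} =
      (poissonMeasure ρ).real {tickCount none p} := fun p hp => by
    simp [tickCount, (Finset.mem_erase.1 hp).1]
  rw [Finset.prod_congr rfl this]
  simp only [tickCount, poissonMeasure_real_singleton]
  simp
  ring

/-- Distinct pairs of initial configuration and tick pattern give disjoint events. Only an
inequality results, since histories with several ticks in a period are dropped. -/
theorem IsNetworkProcess.sum_le_measureReal [IsProbabilityMeasure P]
    (hG : IsNetworkProcess root dbar C G P) {τ : ℕ → ℝ≥0} (hτ : Monotone τ) (hτ0 : τ 0 = 0)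
    (n : ℕ) (T : Finset (Finset (V × V))) (l : ℕ) :
    ∑ e ∈ T, P.real (G 0 ⁻¹' {e}) * ∑ y : Fin n → Option (V × V),
      (∏ i : Fin n, ∏ p : V × V, (poissonMeasure (1 / (Fintype.card V : ℝ≥0) *
        (τ (i + 1) - τ i))).real {tickCount (y i) p}) *
        (if deep root l (run root dbar n e y) = ∅ then 1 else 0) ≤
      P.real (G 0 ⁻¹' T ∩ {ω | deep root l (G (τ n) ω) = ∅}) := by
  classical
  set K := (T ×ˢ (Finset.univ : Finset (Fin n → Option (V × V)))).filter
    fun x => deep root l (run root dbar n x.1 x.2) = ∅ with hK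
  have hsum : ∑ x ∈ K, P.real (tickEvent C G τ x.1 x.2) =
      P.real (⋃ x ∈ K, tickEvent C G τ x.1 x.2) := by
    refine (measureReal_biUnion_finset ?_ fun x _ => hG.measurableSet_tickEvent τ x.1 x.2).symm
    rintro ⟨e, y⟩ - ⟨e', y'⟩ - hne
    refine Set.disjoint_left.2 ?_
    rintro ω ⟨h1, h2⟩ ⟨h1', h2'⟩
    refine hne ?_
    have he : e = e' := (show G 0 ω = e from h1).symm.trans h1'
    have hy : y = y' := by
      funext i
      have h : ∀ p, tickCount (y i) p = tickCount (y' i) p := fun p =>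
        (h2 p i).symm.trans (h2' p i)
      rcases hi : y i with _ | p <;> rcases hi' : y' i with _ | p'
      · rfl
      · simpa [tickCount, hi, hi'] using h p'
      · simpa [tickCount, hi, hi'] using h p
      · simpa [tickCount, hi, hi', eq_comm] using h p
    rw [he, hy]
  calc _ = ∑ x ∈ K, P.real (tickEvent C G τ x.1 x.2) := by
        rw [hK, Finset.sum_filter, Finset.sum_product]
        refine Finset.sum_congr rfl fun e _ => ?_
        rw [Finset.mul_sum]
        refine Finset.sum_congr rfl fun y _ => ?_
        rw [hG.measureReal_tickEvent hτ]
        split_ifs <;> simp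
    _ = _ := hsum
    _ ≤ _ := by
        refine ENNReal.toReal_mono (measure_ne_top _ _) (measure_mono_ae ?_)
        have hmono : ∀ᵐ ω ∂P, ∀ p, Monotone fun t => C p t ω :=
          ae_all_iff.2 fun p => (hG.poisson p).mono
        filter_upwards [hG.driven, hmono] with ω hd hm hω
        obtain ⟨⟨e, y⟩, hx, h1, h2⟩ := Set.mem_iUnion₂.1 hω
        obtain ⟨hT, hdeep⟩ := Finset.mem_filter.1 hx
        have he : G 0 ω = e := h1
        have hrun := hd.eq_run n τ hτ y fun i p => by
          have h3 := h2 p i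
          -- Subtraction in ℕ is truncated; monotone paths make the increments genuine.
          have h4 : C p (τ i) ω ≤ C p (τ (i + 1)) ω := hm p (hτ (Nat.le_succ _))
          dsimp only at h3 ⊢
          omega
        refine ⟨?_, ?_⟩
        · simpa [he] using (Finset.mem_product.1 hT).1
        · simp only [hτ0, he] at hrun
          exact (congrArg (fun g => deep root l g = ∅) hrun).mpr hdeep

end Law

theorem coverTime_le_of_deep_eq_empty {V Ω : Type*} [Fintype V] [DecidableEq V] {root : V}
    {G : ℝ≥0 → Ω → Finset (V × V)} {t : ℝ≥0} {ω : Ω}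
    (h : deep root (levelC (Fintype.card V) + 1) (G t ω) = ∅) :
    coverTime root G ω ≤ (t : WithTop ℝ≥0) := by
  refine hittingAfter_le_of_mem zero_le ?_
  have := numWithin_add_card_deep (root := root) (E := G t ω) (levelC (Fintype.card V) + 1)
  rw [h, Finset.card_empty, add_zero] at this
  exact this

/-! ### Equal periods and the limit n → ∞ -/

section Limit

variable {V Ω : Type*} [Fintype V] [DecidableEq V] [MeasurableSpace Ω] {P : Measure Ω}
  {root : V} {dbar : V → ℕ} {C : V × V → ℝ≥0 → Ω → ℕ} {G : ℝ≥0 → Ω → Finset (V × V)}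

/-- The weight of a tick pattern during one period, the clocks having mean `ρ` over the period. -/
noncomputable def tickWeight (ρ : ℝ≥0) (y : Option (V × V)) : ℝ :=
  ∏ p : V × V, (poissonMeasure ρ).real {tickCount y p}

/-- The probability of at most one tick in a period, the total number of ticks being Poisson of mean
N²ρ. -/
theorem sum_tickWeight (ρ : ℝ≥0) :
    ∑ y : Option (V × V), tickWeight ρ y =
      Real.exp (-(Fintype.card V ^ 2 * ρ)) * (1 + Fintype.card V ^ 2 * ρ) := by
  simp only [Fintype.sum_option, tickWeight, prod_poissonMeasure_tickCount_none,
    prod_poissonMeasure_tickCount_some, Finset.sum_const, Finset.card_univ, Fintype.card_prod,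
    nsmul_eq_mul]
  push_cast
  ring

theorem measureReal_deep_eq_empty_ge [IsProbabilityMeasure P]
    (hG : IsNetworkProcess root dbar C G P) (hdbar : ∀ u, 2 ≤ dbar u) {κ : ℝ} (hκ : 0 ≤ κ)
    (l : ℕ) (T : Finset (Finset (V × V)))
    (hT : ∀ e ∈ T, (1 / 2 + κ) * Fintype.card V ≤ numWithin root e l) (h : ℝ≥0) (n : ℕ)
    (ρ : ℝ≥0) (hρ : ρ = 1 / (Fintype.card V : ℝ≥0) * h) (θ : ℝ)
    (hθ : θ = Fintype.card V ^ 2 * ρ) (r : ℝ)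
    (hr : r = κ * Fintype.card V * (Real.exp (-θ) * ρ)) (hr1 : r ≤ 1) :
    P.real (G 0 ⁻¹' T) *
        ((1 - (1 - r) ^ n) ^ ((1 / 2 - κ) * Fintype.card V : ℝ)
          - n * (θ ^ 2 + (Fintype.card V * r) ^ 2)) ≤
      P.real (G 0 ⁻¹' T ∩ {ω | deep root (l + 1) (G (n * h) ω) = ∅}) := by
  have hθ0 : 0 ≤ θ := by rw [hθ]; positivity
  have hr0 : 0 ≤ r := by rw [hr]; positivity
  set τ : ℕ → ℝ≥0 := fun i => i * h with hτdef
  have hτ : Monotone τ := fun i j hij => by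
    simp only [hτdef]
    gcongr
  have hτs : ∀ i, τ (i + 1) - τ i = h := fun i => by
    simp only [hτdef, Nat.cast_succ, add_mul, one_mul, add_tsub_cancel_left]
  have hmain := hG.sum_le_measureReal hτ (by simp [hτdef]) n T (l + 1)
  simp only [hτs, ← hρ] at hmain
  refine le_trans ?_ hmain
  have hpre : P.real (G 0 ⁻¹' T) = ∑ e ∈ T, P.real (G 0 ⁻¹' {e}) := by
    rw [← measureReal_biUnion_finset
      (fun e _ e' _ hne => Set.disjoint_left.2 fun ω h1 h2 => hne (h1.symm.trans h2))
      fun e _ => hG.measurable 0 (measurableSet_singleton e)]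
    congr 1
    ext ω
    simp
  rw [hpre, Finset.sum_mul]
  refine Finset.sum_le_sum fun e he => ?_
  -- Inadmissible initial configurations have probability zero.
  by_cases hE : Admissible root dbar e
  · refine mul_le_mul_of_nonneg_left ?_ measureReal_nonneg
    have hexp : 1 - θ ≤ Real.exp (-θ) := Real.one_sub_le_exp_neg θ
    have hrun := le_sum_run (w := tickWeight ρ) (ε := θ ^ 2) (s := Real.exp (-θ) * ρ) hdbar hκ
      (fun y => Finset.prod_nonneg fun p _ => measureReal_nonneg)
      -- e^(-θ)(1 + θ) ≥ (1 - θ)(1 + θ) = 1 - θ².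
      (by rw [sum_tickWeight, ← hθ]; nlinarith)
      (by
        rw [sum_tickWeight, ← hθ, Real.exp_neg, inv_mul_le_one₀ (Real.exp_pos _)]
        linarith [Real.add_one_le_exp θ])
      (sq_nonneg θ)
      (fun p => by rw [tickWeight, prod_poissonMeasure_tickCount_some, hθ])
      (by positivity) (hr ▸ hr1) n e hE (hT e he)
    rw [← hr] at hrun
    refine le_trans (sub_le_sub_right ?_ _) hrun
    rw [← Real.rpow_natCast _ (deep root (l + 1) e).card]
    have hb : (1 - r) ^ n ≤ 1 := pow_le_one₀ (by linarith) (by linarith)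
    have hb' : 0 ≤ (1 - r) ^ n := pow_nonneg (by linarith) _
    -- The base lies in [0, 1], so the number of deep nodes may be replaced by its upper bound (1/2
    -- - κ)N.
    refine Real.rpow_le_rpow_of_exponent_ge' (by linarith) (by linarith) (Nat.cast_nonneg _) ?_
    have h1 : (numWithin root e (l + 1) : ℝ) + (deep root (l + 1) e).card = Fintype.card V := by
      exact_mod_cast numWithin_add_card_deep (l + 1)
    have h2 : (numWithin root e l : ℝ) ≤ numWithin root e (l + 1) := by
      exact_mod_cast numWithin_mono (Nat.le_succ l)
    linarith [hT e he]
  · have h0 : P.real (G 0 ⁻¹' {e}) = 0 := by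
      rw [measureReal_def, measure_mono_null (t := {ω | ¬ Admissible root dbar (G 0 ω)}) ?_
        (ae_iff.1 hG.admissible_init), ENNReal.toReal_zero]
      intro ω hω
      rwa [Set.mem_ofPred_eq, show G 0 ω = e from hω]
    simp [h0]

open Filter Topology in
theorem measureReal_deep_eq_empty_ge_rpow [IsProbabilityMeasure P]
    (hG : IsNetworkProcess root dbar C G P) (hdbar : ∀ u, 2 ≤ dbar u) {κ : ℝ} (hκ : 0 ≤ κ)
    (hκ₁ : κ ≤ 1 / 2) (l : ℕ) (T : Finset (Finset (V × V)))
    (hT : ∀ e ∈ T, (1 / 2 + κ) * Fintype.card V ≤ numWithin root e l) (t : ℝ≥0) :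
    P.real (G 0 ⁻¹' T) *
        (1 - Real.exp (-(κ * t))) ^ ((1 / 2 - κ) * Fintype.card V : ℝ) ≤
      P.real (G 0 ⁻¹' T ∩ {ω | deep root (l + 1) (G t ω) = ∅}) := by
  set N : ℝ := (Fintype.card V : ℝ) with hN
  have hN0 : 0 < N := by
    have : Nonempty V := ⟨root⟩
    exact Nat.cast_pos.2 Fintype.card_pos
  have hlim : Tendsto (fun n : ℕ => P.real (G 0 ⁻¹' T) *
      ((1 - Real.exp (-(κ * t * Real.exp (-(N * t / n))))) ^ ((1 / 2 - κ) * N)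
        - 2 * (N * t) ^ 2 / n)) atTop
      (𝓝 (P.real (G 0 ⁻¹' T) *
        ((1 - Real.exp (-(κ * t * Real.exp (-0)))) ^ ((1 / 2 - κ) * N) - 0))) := by
    refine Tendsto.const_mul _ (Tendsto.sub (Tendsto.rpow_const (Tendsto.const_sub _ ?_)
      (Or.inr (mul_nonneg (by linarith) hN0.le))) (tendsto_const_div_atTop_nhds_zero_nat _))
    have h1 := tendsto_const_div_atTop_nhds_zero_nat (N * t)
    exact (Real.continuous_exp.tendsto _).comp
      ((((Real.continuous_exp.tendsto _).comp h1.neg).const_mul (κ * t)).neg)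
  rw [neg_zero, Real.exp_zero, mul_one, sub_zero] at hlim
  refine le_of_tendsto hlim ?_
  -- This makes n positive and t/n ≤ 1, hence r ≤ 1.
  filter_upwards [eventually_ge_atTop (⌈(t : ℝ)⌉₊ + 1)] with n hn
  have hn0 : (0 : ℝ) < n := by exact_mod_cast (by omega : 0 < n)
  have htn : (t : ℝ) / n ≤ 1 := by
    rw [div_le_one hn0]
    exact (Nat.le_ceil _).trans (by exact_mod_cast (by omega : ⌈(t : ℝ)⌉₊ ≤ n))
  have hnn : (n : ℝ≥0) ≠ 0 := by exact_mod_cast hn0.ne'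
  set h : ℝ≥0 := t / n with hh
  set ρ : ℝ≥0 := 1 / (Fintype.card V : ℝ≥0) * h with hρ
  have hρ' : (ρ : ℝ) = t / (N * n) := by
    rw [hρ, hh]
    push_cast
    rw [← hN]
    field_simp
  have hθ : N ^ 2 * ρ = N * t / n := by
    rw [hρ']
    field_simp
  have hr : κ * N * (Real.exp (-(N ^ 2 * ρ)) * ρ) = κ * (t / n) * Real.exp (-(N * t / n)) := by
    rw [hθ, hρ']
    field_simp
  have hexp : Real.exp (-(N * t / n)) ≤ 1 := Real.exp_le_one_iff.2 (by
    rw [neg_nonpos]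
    positivity)
  have hrt : κ * (t / n) * Real.exp (-(N * t / n)) ≤ t / n :=
    calc κ * (t / n) * Real.exp (-(N * t / n)) ≤ 1 * (t / n) * 1 := by
          gcongr
          linarith
      _ = _ := by ring
  have hr0 : 0 ≤ κ * (t / n) * Real.exp (-(N * t / n)) := by positivity
  have key := measureReal_deep_eq_empty_ge hG hdbar hκ l T hT h n ρ hρ _ rfl _ rfl
    (by rw [← hN, hr]; exact hrt.trans htn)
  rw [show (n : ℝ≥0) * h = t from mul_div_cancel₀ _ hnn, ← hN, hr, hθ] at key
  refine le_trans (mul_le_mul_of_nonneg_left ?_ measureReal_nonneg) key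
  set r := κ * (t / n) * Real.exp (-(N * t / n)) with hrdef
  refine sub_le_sub ?_ ?_
  · have h1 : (1 - r) ^ n ≤ Real.exp (-(κ * t * Real.exp (-(N * t / n)))) :=
      calc (1 - r) ^ n ≤ Real.exp (-r) ^ n :=
            pow_le_pow_left₀ (by linarith) (Real.one_sub_le_exp_neg r) n
        _ = _ := by
            rw [← Real.exp_nat_mul, hrdef]
            congr 1
            field_simp
    refine Real.rpow_le_rpow ?_ (by linarith) (mul_nonneg (by linarith) hN0.le)
    rw [sub_nonneg, Real.exp_le_one_iff, neg_nonpos]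
    positivity
  · have h1 : (N * r) ^ 2 ≤ (N * (t / n)) ^ 2 := by gcongr
    calc n * ((N * t / n) ^ 2 + (N * r) ^ 2)
        ≤ n * ((N * t / n) ^ 2 + (N * (t / n)) ^ 2) := by gcongr
      _ = 2 * (N * t) ^ 2 / n := by field_simp; ring

end Limit

end TreeBalance

/-! ### Conditioning on the initial configuration -/

theorem mainTheorem6 {V Ω : Type*} [Fintype V] [DecidableEq V] [MeasurableSpace Ω]
    (P : Measure Ω) [IsProbabilityMeasure P] (root : V) (dbar : V → ℕ) (hdbar : ∀ u, 2 ≤ dbar u)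
    (C : V × V → ℝ≥0 → Ω → ℕ) (G : ℝ≥0 → Ω → Finset (V × V))
    (hG : TreeBalance.IsNetworkProcess root dbar C G P)
    (α : ℝ) (hα₀ : 0 < α) (hα₁ : α < 1 / 2)
    (hinit : P {ω | (1 - α) * (Fintype.card V : ℝ) ≤
      (TreeBalance.numWithin root (G 0 ω) (TreeBalance.levelA α (Fintype.card V)) : ℝ)} ≠ 0)
    (t : ℝ≥0) :
    (1 - Real.exp (-((1 - 2 * α) * (t : ℝ) / 2))) ^ (α * (Fintype.card V : ℝ)) ≤
      (P[|{ω | (1 - α) * (Fintype.card V : ℝ) ≤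
        (TreeBalance.numWithin root (G 0 ω)
          (TreeBalance.levelA α (Fintype.card V)) : ℝ)}]).real
        {ω | TreeBalance.coverTime root G ω ≤ (t : WithTop ℝ≥0)} := by
  classical
  set T : Finset (Finset (V × V)) := Finset.univ.filter fun e =>
    (1 - α) * (Fintype.card V : ℝ) ≤
      (TreeBalance.numWithin root e (TreeBalance.levelA α (Fintype.card V)) : ℝ) with hT
  have hA : {ω | (1 - α) * (Fintype.card V : ℝ) ≤ (TreeBalance.numWithin root (G 0 ω)
      (TreeBalance.levelA α (Fintype.card V)) : ℝ)} = G 0 ⁻¹' T := by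
    ext ω
    simp [hT]
  rw [hA] at hinit ⊢
  have hmeas : MeasurableSet (G 0 ⁻¹' (T : Set (Finset (V × V)))) :=
    hG.measurable 0 (Set.toFinite _).measurableSet
  have hpos : 0 < P.real (G 0 ⁻¹' (T : Set (Finset (V × V)))) :=
    ENNReal.toReal_pos hinit (measure_ne_top _ _)
  -- This κ gives 1/2 + κ = 1 - α for the initial level, rate (1 - 2α)/2 and exponent αN.
  have key := TreeBalance.measureReal_deep_eq_empty_ge_rpow hG hdbar (κ := 1 / 2 - α)
    (by linarith) (by linarith) (TreeBalance.levelC (Fintype.card V)) T (fun e he => by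
      have h1 := (Finset.mem_filter.1 he).2
      have h2 : (TreeBalance.numWithin root e (TreeBalance.levelA α (Fintype.card V)) : ℝ) ≤
          TreeBalance.numWithin root e (TreeBalance.levelC (Fintype.card V)) := by
        exact_mod_cast TreeBalance.numWithin_mono
          (TreeBalance.levelA_le_levelC hα₀.le _ (by linarith))
      linarith) t
  rw [measureReal_def, cond_apply hmeas, ENNReal.toReal_mul, ENNReal.toReal_inv, ← measureReal_def,
    ← measureReal_def, inv_mul_eq_div, le_div_iff₀ hpos, mul_comm]
  calc _ = P.real (G 0 ⁻¹' T) * (1 - Real.exp (-((1 / 2 - α) * t))) ^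
        ((1 / 2 - (1 / 2 - α)) * Fintype.card V : ℝ) := by
        congr 3
        · congr 3
          ring
        · ring
    _ ≤ _ := key
    _ ≤ _ := measureReal_mono (Set.inter_subset_inter_right _ fun ω hω =>
        TreeBalance.coverTime_le_of_deep_eq_empty hω)
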